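/- \textbf{Theorem (order conditions for LIRK-W methods of type 2).} Let $s\ge 0$ and let real coefficients $a_{i,j}$, $\gamma_{i,j}$, $b_j$, $g_j$ ($1\le i,j\le s$) be given with $a_{i,j}=0$ for $j\ge i$ and $\gamma_{i,j}=0$ for $j>i$. For an initial value problem $y'=F(y)$, $y(t_0)=y_0$, with $F:\mathbb{R}^N\to\mathbb{R}^N$ smooth, and an arbitrary smooth time-dependent matrix $\mathbf{L}:\mathbb{R}\to\mathbb{R}^{N\times N}$, one step of size $h$ of the type 2 LIRK-W method is $$Y_i = y_0 + h\sum_{j=1}^{i-1} a_{i,j}F(Y_j) + h\,\mathbf{L}\sum_{j=1}^{i-1}\gamma_{i,j}Y_j + h\gamma_{i,i}\mathbf{L}_iY_i,\quad i=1,\dots,s,$$ $$y_1 = y_0 + h\sum_{j=1}^{s} b_jF(Y_j) + h\,\mathbf{L}\sum_{j=1}^{s} g_jY_j,$$ where $\mathbf{L}=\mathbf{L}(t_0)$ and $\mathbf{L}_i=\mathbf{L}(t_0+h\gamma_{i,i})$. The method has order $p$ if for all $N$, $F$, $\mathbf{L}$, $t_0$, $y_0$ and every solution $y$ of the problem on an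 interval $[t_0,t_F]$, $t_F>t_0$, the stage equations are solvable for all sufficiently small $h>0$ and $\|y_1-y(t_0+h)\|\le C h^{p+1}$ for all sufficiently small $h>0$, with $C$ independent of $h$. $LW_1$-trees are rooted trees with meagre, fat and square vertices in which every fat vertex has at most one child and every square vertex has exactly one child, which is square or fat. $LW_2$ is the set of $LW_1$-trees whose root is not square, and $T\subset LW_2$ is the set of Butcher trees (all vertices meagre). Write $[\tau_1,\dots,\tau_m]_\bullet$ for the tree with meagre root carrying the subtrees $\tau_1,\dots,\tau_m$, $[\tau]_\circ$ for a fat root carrying $\tau$, and $[\tau]_{\theta_q}$ for a chain of $q\ge 1$ square vertices followed by a fat vertex carrying $\tau$; $[\,]_\bullet$, $[\,]_\circ$, $[\,]_{\theta_q}$ are the corresponding trees with nothing attached. For $1\le j\le s$ define on $LW_1$ $$\bar\Phi^2_j([\tau_1,\dots,\tau_m]_\bullet)=\sum_k a_{j,k}\prod_{i=1}^m\bar\Phi^2_k(\tau_i),\quad \bar\Phi^2_j([\tau]_\circ)=\sum_k\gamma_{j,k}\bar\Phi^2_k(\tau),\quad \bar\Phi^2_j([\tau]_{\theta_q})=\gamma_{j,j}^{q+1}\bar\Phi^2_j(\tau),$$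 $$\bar\Phi^2_j([\,]_\bullet)=\sum_k a_{j,k},\quad \bar\Phi^2_j([\,]_\circ)=\sum_k\gamma_{j,k},\quad \bar\Phi^2_j([\,]_{\theta_q})=\gamma_{j,j}^{q+1},$$ and on $LW_2$ $$\Phi^2_j([\tau_1,\dots,\tau_m]_\bullet)=b_j\prod_{i=1}^m\bar\Phi^2_j(\tau_i),\quad \Phi^2_j([\tau]_\circ)=g_j\bar\Phi^2_j(\tau),\quad \Phi^2_j([\,]_\bullet)=b_j,\quad \Phi^2_j([\,]_\circ)=g_j.$$ Let $\rho(\tau)$ be the number of vertices of $\tau$, and $\gamma(\tau)$ the product of $\rho(\tau)$ and all orders of the trees which appear if the roots, one after another, are removed from $\tau$. Then, for every integer $p\ge 0$, the method has order $p$ if and only if $$\sum_j\Phi^2_j(\tau)=\frac{1}{\gamma(\tau)}\quad\text{for all }\tau\in T\text{ with }\rho(\tau)\le p,$$ $$\sum_j\Phi^2_j(\tau)=0\quad\text{for all }\tau\in LW_2\setminus T\text{ with }\rho(\tau)\le p.$$ -/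

import Mathlib

open scoped ContDiff

/-! ### The methods and their order -/

/-- The coefficients of an `s`-stage LIRK-W method of type 2. -/
structure LIRKW2 (s : ℕ) where
  a : Fin s → Fin s → ℝ
  γ : Fin s → Fin s → ℝ
  b : Fin s → ℝ
  g : Fin s → ℝ
  /-- `a` is strictly lower triangular. -/
  a_lower : ∀ i j, i ≤ j → a i j = 0
  /-- `γ` is lower triangular (with a possibly nonzero diagonal). -/
  γ_lower : ∀ i j, i < j → γ i j = 0

/-- `φ` solves `y' = F(y)`, `y(t₀) = y₀` on `[t₀, tF]`. -/
def IsSolutionOn {N : ℕ} (F : (Fin N → ℝ) → (Fin N → ℝ)) (t₀ tF : ℝ) (y₀ : Fin N → ℝ)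
    (φ : ℝ → Fin N → ℝ) : Prop :=
  φ t₀ = y₀ ∧
    ∀ t ∈ Set.Icc t₀ tF, HasDerivWithinAt φ (F (φ t)) (Set.Icc t₀ tF) t

namespace LIRKW2

variable {s : ℕ}

/-- `Y` solves the stage equations of one step of size `h` from `(t₀, y₀)`:
`Y_i = y₀ + h ∑_{j<i} a_{ij} F(Y_j) + h L(t₀) ∑_{j<i} γ_{ij} Y_j + h γ_{ii} L(t₀ + h γ_{ii}) Y_i`. -/
def IsStages (M : LIRKW2 s) {N : ℕ} (F : (Fin N → ℝ) → (Fin N → ℝ))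
    (L : ℝ → Matrix (Fin N) (Fin N) ℝ) (t₀ : ℝ) (y₀ : Fin N → ℝ) (h : ℝ)
    (Y : Fin s → Fin N → ℝ) : Prop :=
  ∀ i, Y i = y₀ + h • (∑ j ∈ Finset.Iio i, M.a i j • F (Y j))
    + h • (L t₀).mulVec (∑ j ∈ Finset.Iio i, M.γ i j • Y j)
    + (h * M.γ i i) • (L (t₀ + h * M.γ i i)).mulVec (Y i)

/-- The new approximation `y₁ = y₀ + h ∑ b_j F(Y_j) + h L(t₀) ∑ g_j Y_j`. -/
def step (M : LIRKW2 s) {N : ℕ} (F : (Fin N → ℝ) → (Fin N → ℝ))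
    (L : ℝ → Matrix (Fin N) (Fin N) ℝ) (t₀ : ℝ) (y₀ : Fin N → ℝ) (h : ℝ)
    (Y : Fin s → Fin N → ℝ) : Fin N → ℝ :=
  y₀ + h • (∑ j, M.b j • F (Y j)) + h • (L t₀).mulVec (∑ j, M.g j • Y j)

/-- The method has order `p`: for every smooth problem `y' = F(y)`, in every dimension, and every
smooth time dependent matrix `L`, for all small step sizes `h > 0` the stage equations are
solvable and the local error is at most `C h ^ (p + 1)`, with `C` independent of `h`. -/
def HasOrder (M : LIRKW2 s) (p : ℕ) : Prop :=
  ∀ (N : ℕ) (F : (Fin N → ℝ) → (Fin N → ℝ)) (L : ℝ → Matrix (Fin N) (Fin N) ℝ)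
    (t₀ tF : ℝ) (y₀ : Fin N → ℝ) (φ : ℝ → Fin N → ℝ),
    ContDiff ℝ ∞ F → (∀ k l, ContDiff ℝ ∞ fun t => L t k l) → t₀ < tF →
    IsSolutionOn F t₀ tF y₀ φ →
    ∃ C : ℝ, ∀ᶠ h in nhdsWithin (0 : ℝ) (Set.Ioi 0),
      (∃ Y, M.IsStages F L t₀ y₀ h Y) ∧
      ∀ Y, M.IsStages F L t₀ y₀ h Y →
        ‖M.step F L t₀ y₀ h Y - φ (t₀ + h)‖ ≤ C * h ^ (p + 1)

end LIRKW2

/-! ### Trees -/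

/-- `LW₁`-trees: rooted trees with meagre, fat and square vertices, in which a fat vertex has at
most one child and a square vertex has exactly one child, which is square or fat. A square vertex
is therefore the start of a unique chain of squares that ends in a fat vertex, and the
constructors are the ways to attach subtrees to a root.

The children of a meagre vertex are listed in some order. All functions below are invariant
under reordering, so a statement about all listings is the statement about all rooted trees. -/
inductive LWTree : Type
  /-- `[τ₁, …, τₘ]_•`, subtrees attached to a meagre root; `m = 0` is the single meagre vertex. -/
  | meagre (m : ℕ) (τ : Fin m → LWTree) : LWTree
  /-- `[]_∘`, the single fat vertex. -/
  | fatLeaf : LWTree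
  /-- `[τ]_∘`, a subtree attached to a fat root. -/
  | fat (τ : LWTree) : LWTree
  /-- `[]_{θ_p}`, a chain of `p ≥ 1` square vertices followed by a childless fat vertex. -/
  | thetaLeaf (p : ℕ+) : LWTree
  /-- `[τ]_{θ_p}`, a chain of `p ≥ 1` square vertices followed by a fat vertex carrying `τ`. -/
  | theta (p : ℕ+) (τ : LWTree) : LWTree

namespace LWTree

/-- `ρ(τ)`, the number of vertices. -/
def order : LWTree → ℕ
  | meagre _ τ => 1 + ∑ i, (τ i).order
  | fatLeaf => 1
  | fat τ => 1 + τ.order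
  | thetaLeaf p => p + 1
  | theta p τ => p + 1 + τ.order

/-- `γ(τ)`, the product of `ρ(τ)` and of the orders of all trees that appear when the roots, one
after another, are removed. -/
def density : LWTree → ℕ
  | meagre m τ => (meagre m τ).order * ∏ i, (τ i).density
  | fatLeaf => 1
  | fat τ => (1 + τ.order) * τ.density
  | thetaLeaf p => ∏ i ∈ Finset.range (p + 1), (i + 1)
  | theta p τ => (∏ i ∈ Finset.range (p + 1), (i + 1 + τ.order)) * τ.density

/-- The set `T` of Butcher trees: all vertices are meagre. -/
def IsButcher : LWTree → Prop
  | meagre _ τ => ∀ i, (τ i).IsButcher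
  | fatLeaf => False
  | fat _ => False
  | thetaLeaf _ => False
  | theta _ _ => False

/-- The set `LW₂`: the `LW₁`-trees whose root is not a square vertex. -/
def IsLW2 : LWTree → Prop
  | meagre _ _ => True
  | fatLeaf => True
  | fat _ => True
  | thetaLeaf _ => False
  | theta _ _ => False

end LWTree

/-! ### Elementary weights -/

namespace LIRKW2

variable {s : ℕ}

/-- The internal weights `Φ̄²_j(τ)` (repeated stage indices are summed over). -/
def PhiBar (M : LIRKW2 s) : LWTree → Fin s → ℝ
  | .meagre _ τ, j => ∑ k, M.a j k * ∏ i, M.PhiBar (τ i) k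
  | .fatLeaf, j => ∑ k, M.γ j k
  | .fat τ, j => ∑ k, M.γ j k * M.PhiBar τ k
  | .thetaLeaf p, j => M.γ j j ^ ((p : ℕ) + 1)
  | .theta p τ, j => M.γ j j ^ ((p : ℕ) + 1) * M.PhiBar τ j

/-- The weights `Φ²_j(τ)` of `LW₂`-trees. Trees with a square root are not `LW₂`-trees; the value
on them is a placeholder. -/
def Phi (M : LIRKW2 s) : LWTree → Fin s → ℝ
  | .meagre _ τ, j => M.b j * ∏ i, M.PhiBar (τ i) j
  | .fatLeaf, j => M.g j
  | .fat τ, j => M.g j * M.PhiBar τ j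
  | .thetaLeaf _, _ => 0
  | .theta _ _, _ => 0

end LIRKW2

/-! Both the stages and the exact solution are expanded in series `∑ h ^ ρ(τ) c(τ) D(τ)`, where `D`
is `elemDiff`: derivatives of `F` and Taylor coefficients of `L`, divided by factorials. Since the
children of a meagre vertex are listed in order, a multilinear expansion meets each listing exactly
once and no symmetry factors appear.

Two operations act on such series. The map `y ↦ h F(y)` grafts subtrees onto a meagre root
(`smul_comp_contDiff`), and `y ↦ h ^ (q + 1) L⁽q⁾ y / q!` grafts at most one subtree onto `q`
squares ending in a fat vertex (`smul_taylorCoeff`). Each gains a power of `h`, so an equation built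
from them determines its coefficients order by order: the stage equations give `PhiBar`, the step
gives `Phi`, and the differential equation gives `1 / γ(τ)` on Butcher trees and `0` elsewhere.
Equality of the coefficients up to order `p` then gives order `p`.

Conversely, one polynomial test problem has a coordinate for each tree. There the numerical and
exact values in coordinate `τ` are exactly `h ^ ρ(τ) ∑ Φ_j(τ)` and `h ^ ρ(τ)` times the exact
coefficient, so an error `O(h ^ (p + 1))` forces equality whenever `ρ(τ) ≤ p`. -/

open Filter Topology Asymptotics

/-! ### Taylor expansion in normed spaces -/

section Taylor

variable {E V : Type*} [NormedAddCommGroup E] [NormedSpace ℝ E]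
  [NormedAddCommGroup V] [NormedSpace ℝ V]

theorem iteratedDeriv_comp_line {f : E → V} (hf : ContDiff ℝ ∞ f) (x z : E) (m : ℕ) (t : ℝ) :
    iteratedDeriv m (fun t : ℝ => f (x + t • z)) t =
      iteratedFDeriv ℝ m f (x + t • z) fun _ => z := by
  have h1 : (fun t : ℝ => f (x + t • z)) =
      (fun w => f (x + w)) ∘ (ContinuousLinearMap.toSpanSingleton ℝ z) := by
    ext t; simp
  have h2 : ContDiff ℝ ∞ fun w => f (x + w) := hf.comp (contDiff_const.add contDiff_id)
  rw [iteratedDeriv_eq_iteratedFDeriv, h1,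
    ContinuousLinearMap.iteratedFDeriv_comp_right _ h2 _ (by exact_mod_cast le_top),
    iteratedFDeriv_comp_add_left]
  simp

/-- One-variable Taylor on the segment `t ↦ x + t • z`, `t ∈ [0, 1]`. By continuity the derivative
of order `n + 1` stays below a constant `K` near `x`, which makes the bound uniform in `z`. -/
theorem taylor_isBigO_norm_pow {f : E → V} (hf : ContDiff ℝ ∞ f) (x : E) (n : ℕ) :
    (fun z => f (x + z) - ∑ m ∈ Finset.range (n + 1),
      ((m.factorial : ℝ)⁻¹) • iteratedFDeriv ℝ m f x fun _ => z) =O[𝓝 0]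
      fun z => ‖z‖ ^ (n + 1) := by
  have hc : Continuous fun y => ‖iteratedFDeriv ℝ (n + 1) f y‖ :=
    (hf.continuous_iteratedFDeriv (by exact_mod_cast le_top)).norm
  obtain ⟨ε, hε, hK⟩ := Metric.eventually_nhds_iff_ball.1
    (hc.continuousAt.eventually (gt_mem_nhds (lt_add_one ‖iteratedFDeriv ℝ (n + 1) f x‖)))
  set K := ‖iteratedFDeriv ℝ (n + 1) f x‖ + 1
  refine IsBigO.of_bound K ?_
  filter_upwards [Metric.ball_mem_nhds (0 : E) hε] with z hz
  rw [mem_ball_zero_iff] at hz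
  set g : ℝ → V := fun t : ℝ => f (x + t • z) with hg
  have hgs : ContDiff ℝ ∞ g :=
    hf.comp (contDiff_const.add (contDiff_id.smul contDiff_const))
  have hw : ∀ m : ℕ, ∀ t ∈ Set.Icc (0 : ℝ) 1,
      iteratedDerivWithin m g (Set.Icc 0 1) t = iteratedFDeriv ℝ m f (x + t • z) fun _ => z := by
    intro m t ht
    rw [iteratedDerivWithin_eq_iteratedDeriv (uniqueDiffOn_Icc zero_lt_one)
      (hgs.contDiffAt.of_le (by exact_mod_cast le_top)) ht, hg, iteratedDeriv_comp_line hf]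
  have hK0 : 0 ≤ K := by positivity
  have key := taylor_mean_remainder_bound (f := g) (a := 0) (b := 1) (x := 1) (n := n)
    (C := K * ‖z‖ ^ (n + 1)) zero_le_one
    (hgs.contDiffOn.of_le (by exact_mod_cast le_top)) (by simp) (by
      intro t ht
      rw [hw _ t ht]
      refine (ContinuousMultilinearMap.le_opNorm _ _).trans ?_
      rw [Finset.prod_const, Finset.card_univ, Fintype.card_fin]
      refine mul_le_mul_of_nonneg_right (hK _ ?_).le (by positivity)
      rw [mem_ball_iff_norm, add_sub_cancel_left, norm_smul, Real.norm_of_nonneg ht.1]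
      exact (mul_le_of_le_one_left (norm_nonneg _) ht.2).trans_lt hz)
  have e : taylorWithinEval g n (Set.Icc 0 1) 0 1 = ∑ m ∈ Finset.range (n + 1),
      ((m.factorial : ℝ)⁻¹) • iteratedFDeriv ℝ m f x fun _ => z := by
    rw [taylor_within_apply]
    refine Finset.sum_congr rfl fun m _ => ?_
    rw [hw m 0 (by simp)]
    simp
  rw [e] at key
  simp only [hg, one_smul, sub_zero, one_pow, mul_one] at key
  rw [norm_pow, norm_norm]
  refine key.trans (div_le_self (by positivity) ?_)
  exact_mod_cast Nat.one_le_iff_ne_zero.2 n.factorial_ne_zero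

end Taylor

/-! ### Combinatorics of trees -/

namespace LWTree

theorem order_pos (τ : LWTree) : 0 < τ.order := by
  cases τ <;> simp [order]

/-- A chain of `q` square vertices followed by a fat vertex, carrying at most one subtree. -/
def chain : ℕ → Option LWTree → LWTree
  | 0, none => fatLeaf
  | 0, some τ => fat τ
  | q + 1, none => thetaLeaf q.succPNat
  | q + 1, some τ => theta q.succPNat τ

theorem order_chain (q : ℕ) (o : Option LWTree) :
    (chain q o).order = q + 1 + o.elim 0 order := by
  rcases q with _ | q <;> rcases o with _ | τ <;> simp [chain, order]

/-- A fat root is a chain with `q = 0`, just as `L t₀` is the Taylor coefficient of degree `0`. This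
reduces later case distinctions to two. -/
theorem eq_meagre_or_eq_chain (τ : LWTree) :
    (∃ m f, τ = meagre m f) ∨ ∃ q o, τ = chain q o := by
  cases τ with
  | meagre m f => exact .inl ⟨m, f, rfl⟩
  | fatLeaf => exact .inr ⟨0, none, rfl⟩
  | fat τ => exact .inr ⟨0, some τ, rfl⟩
  | thetaLeaf p => exact .inr ⟨p.natPred + 1, none, by simp [chain]⟩
  | theta p τ => exact .inr ⟨p.natPred + 1, some τ, by simp [chain]⟩

theorem chain_injective2 : Function.Injective2 chain := by
  intro q q' o o' h
  rcases q with _ | q <;> rcases q' with _ | q' <;> rcases o with _ | τ <;>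
    rcases o' with _ | τ' <;> simp_all [chain]

theorem order_le_of_meagre {m : ℕ} (f : Fin m → LWTree) (i : Fin m) :
    (f i).order < (meagre m f).order := by
  have := Finset.single_le_sum (f := fun i => (f i).order) (fun _ _ => Nat.zero_le _)
    (Finset.mem_univ i)
  simp only [order] at *
  omega

theorem lt_order_meagre {m : ℕ} (f : Fin m → LWTree) : m < (meagre m f).order := by
  have : ∑ _i : Fin m, 1 ≤ ∑ i, (f i).order := Finset.sum_le_sum fun i _ => (f i).order_pos
  simp only [Finset.sum_const, Finset.card_univ, Fintype.card_fin, smul_eq_mul, mul_one] at this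
  simp only [order]
  omega

/-- A tree has fewer children, and fewer squares in its root chain, than vertices, and its subtrees
are strictly smaller. The next level is thus a finite union of images of finite sets. -/
theorem finite_order_le (n : ℕ) : {τ : LWTree | τ.order ≤ n}.Finite := by
  induction n with
  | zero =>
    convert Set.finite_empty
    ext τ
    simpa using τ.order_pos.ne'
  | succ n ih =>
    have h1 : (⋃ m ∈ Set.Iio (n + 1), meagre m '' {f | ∀ i, (f i).order ≤ n}).Finite :=
      (Set.finite_Iio _).biUnion fun m _ => (Set.Finite.pi' fun _ => ih).image _
    have h2 : (⋃ q ∈ Set.Iio (n + 1), chain q '' insert none (some '' {τ | τ.order ≤ n})).Finite :=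
      (Set.finite_Iio _).biUnion fun q _ => ((ih.image _).insert _).image _
    refine (h1.union h2).subset fun τ (hτ : τ.order ≤ n + 1) => ?_
    rcases τ.eq_meagre_or_eq_chain with ⟨m, f, rfl⟩ | ⟨q, o, rfl⟩
    · refine .inl (Set.mem_biUnion (x := m) ((lt_order_meagre f).trans_le hτ) ⟨f, fun i => ?_, rfl⟩)
      have := order_le_of_meagre f i
      omega
    · rw [order_chain] at hτ
      refine .inr (Set.mem_biUnion (x := q) (show q < n + 1 by omega) ⟨o, ?_, rfl⟩)
      rcases o with _ | τ
      · simp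
      · simp only [Option.elim_some] at hτ
        simp
        omega

/-- The finite set of trees with at most `n` vertices. -/
noncomputable def treesLE (n : ℕ) : Finset LWTree := (finite_order_le n).toFinset

@[simp] theorem mem_treesLE {n : ℕ} {τ : LWTree} : τ ∈ treesLE n ↔ τ.order ≤ n := by
  simp [treesLE]

/-- The coefficients of `h F(y)` in terms of those of `y`. -/
def meagreCoeff (c : LWTree → ℝ) : LWTree → ℝ
  | meagre _ f => ∏ i, c (f i)
  | _ => 0

/-- The coefficients of `h ^ (q + 1) L⁽q⁾ y / q!` in terms of those of `y`. -/
def chainCoeff (q : ℕ) (c : LWTree → ℝ) : LWTree → ℝ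
  | meagre _ _ => 0
  | fatLeaf => if q = 0 then 1 else 0
  | fat τ => if q = 0 then c τ else 0
  | thetaLeaf p => if q = p then 1 else 0
  | theta p τ => if q = p then c τ else 0

@[simp] theorem meagreCoeff_chain (c : LWTree → ℝ) (q : ℕ) (o : Option LWTree) :
    meagreCoeff c (chain q o) = 0 := by
  rcases q with _ | q <;> rcases o with _ | τ <;> rfl

theorem chainCoeff_chain (c : LWTree → ℝ) (q q' : ℕ) (o : Option LWTree) :
    chainCoeff q c (chain q' o) = if q = q' then o.elim 1 c else 0 := by
  rcases q' with _ | q' <;> rcases o with _ | τ <;> simp [chain, chainCoeff] <;> rfl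

end LWTree

/-! ### Elementary differentials and expansions in trees -/

section BSeries

variable {V : Type*} [NormedAddCommGroup V] [NormedSpace ℝ V] {α : Type*}

/-- The Taylor coefficient of degree `q` of a curve `L` at `t`. -/
noncomputable def taylorCoeff (L : ℝ → V) (t : ℝ) (q : ℕ) : V :=
  ((q.factorial : ℝ)⁻¹) • iteratedFDeriv ℝ q L t fun _ => 1

/-- The elementary differentials of `F` and `L`, divided by factorials. -/
noncomputable def elemDiff (F : V → V) (L : ℝ → V →L[ℝ] V) (t₀ : ℝ) (y₀ : V) : LWTree → V
  | .meagre m f => ((m.factorial : ℝ)⁻¹) •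
      iteratedFDeriv ℝ m F y₀ fun i => elemDiff F L t₀ y₀ (f i)
  | .fatLeaf => L t₀ y₀
  | .fat τ => L t₀ (elemDiff F L t₀ y₀ τ)
  | .thetaLeaf q => taylorCoeff L t₀ q y₀
  | .theta q τ => taylorCoeff L t₀ q (elemDiff F L t₀ y₀ τ)

theorem elemDiff_chain (F : V → V) (L : ℝ → V →L[ℝ] V) (t₀ : ℝ) (y₀ : V) (q : ℕ)
    (o : Option LWTree) : elemDiff F L t₀ y₀ (.chain q o) =
      taylorCoeff L t₀ q (o.elim y₀ (elemDiff F L t₀ y₀)) := by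
  rcases q with _ | q <;> rcases o with _ | τ <;> simp [LWTree.chain, elemDiff, taylorCoeff] <;>
    rfl

/-- `δ` agrees with the tree series with coefficients `c` in the small parameter `h`
up to an error `O(h ^ (n + 1))`. -/
def HasTreeSeries (D : LWTree → V) (l : Filter α) (h : α → ℝ) (n : ℕ) (c : LWTree → ℝ)
    (δ : α → V) : Prop :=
  (fun x => δ x - ∑ τ ∈ LWTree.treesLE n, (h x ^ τ.order * c τ) • D τ) =O[l] fun x => h x ^ (n + 1)

variable {l : Filter α} {h : α → ℝ}

theorem isBigO_pow_of_le (hh : Tendsto h l (𝓝 0)) {m n : ℕ} (hmn : m ≤ n) :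
    (fun x => h x ^ n) =O[l] fun x => h x ^ m := by
  have : (fun y : ℝ => y ^ n) =O[𝓝 0] fun y => y ^ m := by
    obtain ⟨k, rfl⟩ := Nat.exists_eq_add_of_le hmn
    have h1 : (fun y : ℝ => y ^ k) =O[𝓝 0] fun _ => (1 : ℝ) :=
      ((continuous_pow k).tendsto (0 : ℝ)).isBigO_one ℝ
    simpa [pow_add] using (isBigO_refl (fun y : ℝ => y ^ m) (𝓝 0)).mul h1
  exact this.comp_tendsto hh

/-- Expansions naturally produce sums over index sets other than `treesLE`. Terms in only one of the
two sets are harmless when they vanish or carry a high power of `h`. -/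
theorem sum_sub_sum_isBigO (hh : Tendsto h l (𝓝 0)) {ι : Type*} (A B : Finset ι) (w : ι → ℝ)
    (e : ι → ℕ) (D : ι → V) (k : ℕ) (H : ∀ τ, ¬(τ ∈ A ↔ τ ∈ B) → w τ = 0 ∨ k ≤ e τ) :
    (fun x => ∑ τ ∈ A, (h x ^ e τ * w τ) • D τ - ∑ τ ∈ B, (h x ^ e τ * w τ) • D τ) =O[l]
      fun x => h x ^ k := by
  classical
  have key : ∀ τ, ¬(τ ∈ A ↔ τ ∈ B) →
      (fun x => (h x ^ e τ * w τ) • D τ) =O[l] fun x => h x ^ k := by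
    intro τ hτ
    rcases H τ hτ with h0 | h0
    · simpa [h0] using isBigO_zero _ _
    · have h1 : (fun _ : α => w τ • D τ) =O[l] fun _ => (1 : ℝ) := isBigO_const_const _ one_ne_zero _
      simpa [mul_smul] using (isBigO_pow_of_le hh h0).smul h1
  refine ((IsBigO.fun_sum fun τ hτ => key τ ?_).sub
    (IsBigO.fun_sum fun τ hτ => key τ ?_)).congr_left fun x =>
      Finset.sum_sdiff_sub_sum_sdiff <;>
  · rw [Finset.mem_sdiff] at hτ
    tauto

namespace HasTreeSeries

variable {D : LWTree → V} {n : ℕ} {c c' : LWTree → ℝ} {δ δ' : α → V}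

theorem congr_coeff (H : HasTreeSeries D l h n c δ) (hc : ∀ τ : LWTree, τ.order ≤ n → c τ = c' τ) :
    HasTreeSeries D l h n c' δ := by
  refine IsBigO.congr_left H fun x => ?_
  congr 1
  exact Finset.sum_congr rfl fun τ hτ => by rw [hc τ (by simpa using hτ)]

theorem add (H : HasTreeSeries D l h n c δ) (H' : HasTreeSeries D l h n c' δ') :
    HasTreeSeries D l h n (fun τ => c τ + c' τ) fun x => δ x + δ' x := by
  refine (IsBigO.add H H').congr_left fun x => ?_
  simp only [mul_add, add_smul, Finset.sum_add_distrib]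
  abel

theorem const_smul (H : HasTreeSeries D l h n c δ) (r : ℝ) :
    HasTreeSeries D l h n (fun τ => r * c τ) fun x => r • δ x := by
  refine (IsBigO.const_smul_left H r).congr_left fun x => ?_
  simp only [Pi.smul_apply, smul_sub, Finset.smul_sum, smul_smul, mul_left_comm]

theorem zero : HasTreeSeries D l h n (fun _ => 0) fun _ => (0 : V) := by
  simpa [HasTreeSeries] using isBigO_zero _ _

theorem sum {ι : Type*} {s : Finset ι} {c : ι → LWTree → ℝ} {δ : ι → α → V}
    (H : ∀ i ∈ s, HasTreeSeries D l h n (c i) (δ i)) :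
    HasTreeSeries D l h n (fun τ => ∑ i ∈ s, c i τ) fun x => ∑ i ∈ s, δ i x := by
  classical
  induction s using Finset.induction_on with
  | empty => simpa using zero
  | insert i s hi ih =>
    simp only [Finset.sum_insert hi]
    exact (H i (by simp)).add (ih fun j hj => H j (by simp [hj]))

theorem of_isBigO (H : δ =O[l] fun x => h x ^ (n + 1)) : HasTreeSeries D l h n (fun _ => 0) δ := by
  simpa [HasTreeSeries] using H

theorem congr_fun (H : HasTreeSeries D l h n c δ) (e : δ =ᶠ[l] δ') :
    HasTreeSeries D l h n c δ' :=
  IsBigO.congr' H (e.sub (EventuallyEq.refl _ _)) (EventuallyEq.refl _ _)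

theorem of_le (hh : Tendsto h l (𝓝 0)) {m : ℕ} (hmn : m ≤ n) (H : HasTreeSeries D l h n c δ) :
    HasTreeSeries D l h m c δ := by
  refine ((IsBigO.trans H (isBigO_pow_of_le hh (by omega : m + 1 ≤ n + 1))).add
    (sum_sub_sum_isBigO hh (LWTree.treesLE n) (LWTree.treesLE m) c LWTree.order D (m + 1)
      fun τ hτ => .inr ?_)).congr_left fun x => by abel
  simp only [LWTree.mem_treesLE] at hτ
  omega

theorem isBigO (hh : Tendsto h l (𝓝 0)) (H : HasTreeSeries D l h n c δ) : δ =O[l] h := by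
  have h0 := H.of_le hh n.zero_le
  have : LWTree.treesLE 0 = ∅ := by
    ext τ
    simpa using τ.order_pos.ne'
  simpa [HasTreeSeries, this] using h0

theorem tendsto (hh : Tendsto h l (𝓝 0)) (H : HasTreeSeries D l h n c δ) : Tendsto δ l (𝓝 0) :=
  (H.isBigO hh).trans_tendsto hh

theorem partialSum (D : LWTree → V) (l : Filter α) (h : α → ℝ) (n : ℕ) (c : LWTree → ℝ) :
    HasTreeSeries D l h n c fun x => ∑ τ ∈ LWTree.treesLE n, (h x ^ τ.order * c τ) • D τ := by
  simpa [HasTreeSeries] using isBigO_zero _ _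

end HasTreeSeries

variable {F : V → V} {L : ℝ → V →L[ℝ] V} {t₀ : ℝ} {y₀ : V} {n : ℕ} {c : LWTree → ℝ} {δ : α → V}

/-- Multilinearity expands the derivative of degree `m` over all `f : Fin m → A`, and `(m, f) ↦
meagre m f` is injective. The factor `1 / m!` is already part of `elemDiff`. -/
theorem sum_taylor_partialSum (F : V → V) (L : ℝ → V →L[ℝ] V) (t₀ : ℝ) (y₀ : V) (n : ℕ)
    (c : LWTree → ℝ) (A : Finset LWTree) (S : Finset LWTree)
    (hS : ∀ τ, τ ∈ S ↔ ∃ m ≤ n, ∃ f : Fin m → LWTree, (∀ i, f i ∈ A) ∧ .meagre m f = τ) (x : ℝ) :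
    ∑ m ∈ Finset.range (n + 1), ((m.factorial : ℝ)⁻¹) • iteratedFDeriv ℝ m F y₀
      (fun _ => ∑ τ ∈ A, (x ^ τ.order * c τ) • elemDiff F L t₀ y₀ τ) =
    ∑ τ ∈ S, (x ^ (τ.order - 1) * τ.meagreCoeff c) • elemDiff F L t₀ y₀ τ := by
  classical
  have hm : ∀ m, ((m.factorial : ℝ)⁻¹) • iteratedFDeriv ℝ m F y₀
      (fun _ => ∑ τ ∈ A, (x ^ τ.order * c τ) • elemDiff F L t₀ y₀ τ) =
      ∑ f ∈ Fintype.piFinset fun _ : Fin m => A, (x ^ ((LWTree.meagre m f).order - 1) *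
        (LWTree.meagre m f).meagreCoeff c) • elemDiff F L t₀ y₀ (.meagre m f) := by
    intro m
    rw [ContinuousMultilinearMap.map_sum_finset, Finset.smul_sum]
    refine Finset.sum_congr rfl fun f _ => ?_
    rw [ContinuousMultilinearMap.map_smul_univ, Finset.prod_mul_distrib, Finset.prod_pow_eq_pow_sum,
      smul_comm]
    simp [LWTree.order, LWTree.meagreCoeff, elemDiff]
  simp only [hm]
  rw [Finset.sum_sigma']
  refine Finset.sum_bij (fun p _ => LWTree.meagre p.1 p.2) ?_ ?_ ?_ ?_
  · rintro ⟨m, f⟩ hf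
    simp only [Finset.mem_sigma, Finset.mem_range, Fintype.mem_piFinset] at hf
    exact (hS _).2 ⟨m, by omega, f, hf.2, rfl⟩
  · rintro ⟨m, f⟩ _ ⟨m', f'⟩ _ e
    injection e with e1 e2
    subst e1
    simpa using e2
  · intro τ hτ
    obtain ⟨m, hm, f, hf, rfl⟩ := (hS τ).1 hτ
    exact ⟨⟨m, f⟩, by simp; exact ⟨by omega, hf⟩, rfl⟩
  · intros; rfl

/-- Strict differentiability allows `δ` to be replaced by its partial sum `B`, and `B = O(h)` turns
the Taylor remainder of `F` into `O(h ^ (n + 1))`. The version without the factor `h` serves as the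
derivative of the exact solution. -/
theorem HasTreeSeries.comp_contDiff (hF : ContDiff ℝ ∞ F) (hh : Tendsto h l (𝓝 0))
    (H : HasTreeSeries (elemDiff F L t₀ y₀) l h n c δ) :
    (fun x => F (y₀ + δ x) - ∑ τ ∈ LWTree.treesLE (n + 1),
      (h x ^ (τ.order - 1) * τ.meagreCoeff c) • elemDiff F L t₀ y₀ τ) =O[l]
      fun x => h x ^ (n + 1) := by
  classical
  set D := elemDiff F L t₀ y₀ with hD
  set B : α → V := fun x => ∑ τ ∈ LWTree.treesLE n, (h x ^ τ.order * c τ) • D τ with hB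
  have HB : HasTreeSeries D l h n c B := .partialSum D l h n c
  have hstrict : HasStrictFDerivAt F (fderiv ℝ F y₀) y₀ :=
    hF.contDiffAt.hasStrictFDerivAt (by simp)
  have t1 : Tendsto (fun x => (y₀ + δ x, y₀ + B x)) l (𝓝 (y₀, y₀)) := by
    have a := (H.tendsto hh).const_add y₀
    have b := (HB.tendsto hh).const_add y₀
    rw [add_zero] at a b
    rw [nhds_prod_eq]
    exact a.prodMk b
  have s1 : (fun x => F (y₀ + δ x) - F (y₀ + B x)) =O[l] fun x => h x ^ (n + 1) := by
    refine (hstrict.isBigO_sub.comp_tendsto t1).trans (IsBigO.congr_left H fun x => ?_)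
    simp [hB]
  have s2 : (fun x => F (y₀ + B x) - ∑ m ∈ Finset.range (n + 1),
      ((m.factorial : ℝ)⁻¹) • iteratedFDeriv ℝ m F y₀ fun _ => B x) =O[l]
      fun x => h x ^ (n + 1) :=
    ((taylor_isBigO_norm_pow hF y₀ n).comp_tendsto (HB.tendsto hh)).trans
      ((HB.isBigO hh).norm_left.pow (n + 1))
  set S : Finset LWTree := (Finset.range (n + 1)).biUnion fun m =>
    (Fintype.piFinset fun _ : Fin m => LWTree.treesLE n).image (LWTree.meagre m)
  have hS : ∀ τ, τ ∈ S ↔ ∃ m ≤ n, ∃ f : Fin m → LWTree,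
      (∀ i, f i ∈ LWTree.treesLE n) ∧ .meagre m f = τ := by
    intro τ
    simp [S]

  -- `S` also holds trees with more than `n + 1` vertices, whose terms are `O(h ^ (n + 1))`. The
  -- trees of `treesLE (n + 1)` outside `S` are chains, with coefficient zero.
  have s3 := sum_sub_sum_isBigO hh S (LWTree.treesLE (n + 1)) (LWTree.meagreCoeff c)
    (fun τ => τ.order - 1) D (n + 1) (by
      intro τ hτ
      rcases τ.eq_meagre_or_eq_chain with ⟨m, f, rfl⟩ | ⟨q, o, rfl⟩
      · right
        by_contra hlt
        have h1 := LWTree.lt_order_meagre f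
        refine hτ ⟨fun _ => by simp; omega, fun h2 => (hS _).2 ⟨m, ?_, f, fun i => ?_, rfl⟩⟩
        · simp at h2; omega
        · have := LWTree.order_le_of_meagre f i
          simp at h2 ⊢; omega
      · simp)
  refine ((s1.add s2).add s3).congr_left fun x => ?_
  rw [← sum_taylor_partialSum F L t₀ y₀ n c _ S hS]
  abel

theorem HasTreeSeries.smul_comp_contDiff (hF : ContDiff ℝ ∞ F) (hh : Tendsto h l (𝓝 0))
    (H : HasTreeSeries (elemDiff F L t₀ y₀) l h n c δ) :
    HasTreeSeries (elemDiff F L t₀ y₀) l h (n + 1) (LWTree.meagreCoeff c)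
      fun x => h x • F (y₀ + δ x) := by
  refine ((isBigO_refl h l).smul (H.comp_contDiff hF hh)).congr (fun x => ?_) fun x => ?_
  · rw [smul_sub, Finset.smul_sum]
    congr 1
    refine Finset.sum_congr rfl fun τ _ => ?_
    rw [smul_smul, ← mul_assoc, mul_pow_sub_one τ.order_pos.ne']
  · rw [smul_eq_mul, ← pow_succ']

/-- By linearity `y₀` contributes the bare chain, and each term `τ` of the series of `δ` contributes
the chain carrying `τ`. -/
theorem HasTreeSeries.smul_taylorCoeff (hh : Tendsto h l (𝓝 0)) (q : ℕ)
    (H : HasTreeSeries (elemDiff F L t₀ y₀) l h n c δ) :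
    HasTreeSeries (elemDiff F L t₀ y₀) l h (n + 1) (LWTree.chainCoeff q c)
      fun x => h x ^ (q + 1) • taylorCoeff L t₀ q (y₀ + δ x) := by
  classical
  set D := elemDiff F L t₀ y₀ with hD
  set M := taylorCoeff L t₀ q
  have s1 : (fun x => h x ^ (q + 1) • M (δ x - ∑ τ ∈ LWTree.treesLE n, (h x ^ τ.order * c τ) • D τ))
      =O[l] fun x => h x ^ (n + 2) := by
    refine ((isBigO_refl (fun x => h x ^ (q + 1)) l).smul
      ((M.isBigO_comp _ l).trans H)).trans ?_
    simp only [smul_eq_mul, ← pow_add]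
    exact isBigO_pow_of_le hh (by omega)
  set S : Finset LWTree := (insert none ((LWTree.treesLE n).image some)).image (LWTree.chain q)
  have s2 := sum_sub_sum_isBigO hh S (LWTree.treesLE (n + 1)) (LWTree.chainCoeff q c)
    LWTree.order D (n + 2) (by
      intro τ hτ
      rcases τ.eq_meagre_or_eq_chain with ⟨m, f, rfl⟩ | ⟨q', o, rfl⟩
      · exact .inl rfl
      · rw [LWTree.chainCoeff_chain]
        split_ifs with e
        · subst e
          right
          by_contra hlt
          refine hτ ⟨fun _ => by simp; omega, fun h2 => Finset.mem_image_of_mem _ ?_⟩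
          rw [LWTree.mem_treesLE, LWTree.order_chain] at h2
          rcases o with _ | τ
          · simp
          · simp only [Option.elim_some] at h2
            simp; omega
        · exact .inl rfl)
  refine (s1.add s2).congr_left fun x => ?_
  have e : ∑ τ ∈ S, (h x ^ τ.order * τ.chainCoeff q c) • D τ =
      h x ^ (q + 1) • M (y₀ + ∑ τ ∈ LWTree.treesLE n, (h x ^ τ.order * c τ) • D τ) := by
    rw [Finset.sum_image (fun o _ o' _ e => (LWTree.chain_injective2 e).2),
      Finset.sum_insert (by simp), Finset.sum_image (fun _ _ _ _ e => Option.some_injective _ e),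
      map_add, map_sum, smul_add, Finset.smul_sum]
    congr 1
    · simp [LWTree.chainCoeff_chain, LWTree.order_chain, hD, elemDiff_chain, M]
    · refine Finset.sum_congr rfl fun τ _ => ?_
      simp [LWTree.chainCoeff_chain, LWTree.order_chain, hD, elemDiff_chain, M, smul_smul, pow_add,
        mul_assoc]
  rw [e]
  simp only [map_add, map_sub, smul_add, smul_sub]
  abel

end BSeries

/-! ### Expansion of the numerical solution -/

namespace LIRKW2

variable {s : ℕ} (M : LIRKW2 s)

/-- The recursion for `PhiBar`, arranged like the stage equation with `L_i` Taylor expanded. Degree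
`0` of the implicit term completes the `γ` sum by its diagonal entry, and degrees `q ≥ 1` give the
square chains. A chain has at least `q + 1` vertices, so `q ≤ n` suffices. -/
theorem phiBar_eq (τ : LWTree) (i : Fin s) {n : ℕ} (hτ : τ.order ≤ n + 1) :
    M.PhiBar τ i = ∑ j, M.a i j * τ.meagreCoeff (M.PhiBar · j) +
      ∑ j, M.γ i j * τ.chainCoeff 0 (M.PhiBar · j) +
      ∑ q ∈ Finset.Icc 1 n, M.γ i i ^ (q + 1) * τ.chainCoeff q (M.PhiBar · i) := by
  have h0 : ∀ q ∈ Finset.Icc 1 n, q ≠ 0 := fun q hq => by simp at hq; omega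
  cases τ with
  | meagre m f => simp [PhiBar, LWTree.meagreCoeff, LWTree.chainCoeff]
  | fatLeaf =>
    rw [Finset.sum_eq_zero (s := Finset.Icc 1 n) fun q hq => by
      simp [LWTree.chainCoeff, h0 q hq]]
    simp [PhiBar, LWTree.meagreCoeff, LWTree.chainCoeff]
  | fat τ =>
    rw [Finset.sum_eq_zero (s := Finset.Icc 1 n) fun q hq => by
      simp [LWTree.chainCoeff, h0 q hq]]
    simp [PhiBar, LWTree.meagreCoeff, LWTree.chainCoeff]
  | thetaLeaf p =>
    have hp : (p : ℕ) ∈ Finset.Icc 1 n := by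
      simp only [LWTree.order] at hτ
      simp only [Finset.mem_Icc]
      exact ⟨p.pos, by omega⟩
    rw [Finset.sum_eq_single_of_mem _ hp fun q _ hq => by simp [LWTree.chainCoeff, hq]]
    simp [PhiBar, LWTree.meagreCoeff, LWTree.chainCoeff, @eq_comm ℕ 0]
  | theta p τ =>
    have hp : (p : ℕ) ∈ Finset.Icc 1 n := by
      simp only [LWTree.order] at hτ
      simp only [Finset.mem_Icc]
      exact ⟨p.pos, by omega⟩
    rw [Finset.sum_eq_single_of_mem _ hp fun q _ hq => by simp [LWTree.chainCoeff, hq]]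
    simp [PhiBar, LWTree.meagreCoeff, LWTree.chainCoeff, @eq_comm ℕ 0]

theorem phi_eq (τ : LWTree) (j : Fin s) :
    M.Phi τ j = M.b j * τ.meagreCoeff (M.PhiBar · j) +
      M.g j * τ.chainCoeff 0 (M.PhiBar · j) := by
  cases τ <;> simp [Phi, LWTree.meagreCoeff, LWTree.chainCoeff, @eq_comm ℕ 0]

section Expansion

variable {V : Type*} [NormedAddCommGroup V] [NormedSpace ℝ V] {α : Type*}

/-- The stage equations, for a curve of continuous linear maps on a normed space. -/
def StageEq (F : V → V) (L : ℝ → V →L[ℝ] V) (t₀ : ℝ) (y₀ : V) (h : ℝ) (Y : Fin s → V) : Prop :=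
  ∀ i, Y i = y₀ + h • (∑ j ∈ Finset.Iio i, M.a i j • F (Y j))
    + h • L t₀ (∑ j ∈ Finset.Iio i, M.γ i j • Y j)
    + (h * M.γ i i) • L (t₀ + h * M.γ i i) (Y i)

variable {M} {l : Filter α} {h : α → ℝ} {F : V → V} {L : ℝ → V →L[ℝ] V} {t₀ : ℝ} {y₀ : V}
  {Y : α → Fin s → V}

theorem tendsto_shift (hh : Tendsto h l (𝓝 0)) (t₀ r : ℝ) :
    Tendsto (fun x => t₀ + h x * r) l (𝓝 t₀) := by
  simpa using (hh.mul_const r).const_add t₀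

/-- A priori bound, by induction over the stages. The implicit term has a factor tending to zero and
is absorbed into the left side. -/
theorem StageEq.sub_isBigO (hF : Continuous F) (hL : Continuous L) (hh : Tendsto h l (𝓝 0))
    (hY : ∀ᶠ x in l, M.StageEq F L t₀ y₀ (h x) (Y x)) (i : Fin s) :
    (fun x => Y x i - y₀) =O[l] h := by
  induction i using WellFoundedLT.induction with
  | ind i ih =>
    have hYt : ∀ j < i, Tendsto (fun x => Y x j) l (𝓝 y₀) := fun j hj => by
      simpa using ((ih j hj).trans_tendsto hh).add_const y₀
    have hLt : Tendsto (fun x => L (t₀ + h x * M.γ i i)) l (𝓝 (L t₀)) :=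
      (hL.tendsto t₀).comp (tendsto_shift hh t₀ _)
    -- The right side of the stage equation minus `y₀`, with `y₀` in place of `Y_i` in the implicit
    -- term.
    set R : α → V := fun x => h x • (∑ j ∈ Finset.Iio i, M.a i j • F (Y x j))
      + h x • L t₀ (∑ j ∈ Finset.Iio i, M.γ i j • Y x j)
      + (h x * M.γ i i) • L (t₀ + h x * M.γ i i) y₀ with hR
    have smul_bdd : ∀ {u : α → V} {v : V}, Tendsto u l (𝓝 v) → (fun x => h x • u x) =O[l] h := by
      intro u v hu
      simpa using (isBigO_refl h l).smul (hu.isBigO_one ℝ)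
    have hRO : R =O[l] h := by
      refine ((smul_bdd (v := ∑ j ∈ Finset.Iio i, M.a i j • F y₀) ?_).add
        (smul_bdd (v := L t₀ (∑ j ∈ Finset.Iio i, M.γ i j • y₀)) ?_)).add ?_
      · exact tendsto_finsetSum _ fun j hj =>
          ((hF.tendsto y₀).comp (hYt j (by simpa using hj))).const_smul _
      · exact ((L t₀).continuous.tendsto _).comp (tendsto_finsetSum _ fun j hj =>
          (hYt j (by simpa using hj)).const_smul _)
      · simp only [mul_smul]
        exact smul_bdd ((((ContinuousLinearMap.apply ℝ V y₀).continuous.tendsto _).comp hLt).const_smul (M.γ i i))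
    have hsmall : Tendsto (fun x => ‖h x * M.γ i i‖ * ‖L (t₀ + h x * M.γ i i)‖) l (𝓝 0) := by
      simpa using (hh.mul_const (M.γ i i)).norm.mul hLt.norm
    refine IsBigO.trans (IsBigO.of_bound 2 ?_) hRO
    filter_upwards [hY, hsmall.eventually (gt_mem_nhds (show (0 : ℝ) < 1 / 2 by norm_num))]
      with x hx hlt
    have e : Y x i - y₀ = R x + (h x * M.γ i i) • L (t₀ + h x * M.γ i i) (Y x i - y₀) := by
      simp only [map_sub, hR]
      linear_combination (norm := module) (1 : ℝ) • hx i
    have h1 : ‖Y x i - y₀‖ ≤ ‖R x‖ + 1 / 2 * ‖Y x i - y₀‖ := by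
      calc ‖Y x i - y₀‖
          ≤ ‖R x‖ + ‖(h x * M.γ i i) • L (t₀ + h x * M.γ i i) (Y x i - y₀)‖ := by
            nth_rewrite 1 [e]; exact norm_add_le _ _
        _ ≤ ‖R x‖ + 1 / 2 * ‖Y x i - y₀‖ := by
            rw [norm_smul]
            have := (L (t₀ + h x * M.γ i i)).le_opNorm (Y x i - y₀)
            have h2 := mul_le_mul_of_nonneg_left this (norm_nonneg (h x * M.γ i i))
            have h3 := mul_le_mul_of_nonneg_right hlt.le (norm_nonneg (Y x i - y₀))
            linarith
    linarith

theorem taylor_curve_isBigO (hL : ContDiff ℝ ∞ L) (hh : Tendsto h l (𝓝 0)) (t₀ r : ℝ) (n : ℕ) :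
    (fun x => L (t₀ + h x * r) -
      ∑ q ∈ Finset.range (n + 1), (h x * r) ^ q • taylorCoeff L t₀ q) =O[l]
      fun x => h x ^ (n + 1) := by
  have h0 : Tendsto (fun x => h x * r) l (𝓝 0) := by simpa using hh.mul_const r
  have h1 := ((taylor_isBigO_norm_pow hL t₀ n).comp_tendsto h0)
  refine (h1.congr_left fun x => ?_).trans ?_
  · simp only [Function.comp_apply]
    congr 1
    refine Finset.sum_congr rfl fun q _ => ?_
    have := (iteratedFDeriv ℝ q L t₀).map_smul_univ (fun _ => h x * r) fun _ => (1 : ℝ)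
    simp only [smul_eq_mul, mul_one, Finset.prod_const, Finset.card_univ, Fintype.card_fin] at this
    rw [this, taylorCoeff, smul_comm]
  · simp only [Function.comp_def]
    have : (fun x => h x * r) =O[l] h := by
      simpa [mul_comm] using (isBigO_refl h l).const_mul_left r
    exact this.norm_left.pow _

/-- Induction on `n`, for all stages at once. Even the implicit occurrence of `Y_i` carries a factor
`h`, so its expansion to order `n` suffices for order `n + 1` and no inverse has to be expanded. -/
theorem StageEq.hasTreeSeries (hF : ContDiff ℝ ∞ F) (hL : ContDiff ℝ ∞ L) (hh : Tendsto h l (𝓝 0))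
    (hY : ∀ᶠ x in l, M.StageEq F L t₀ y₀ (h x) (Y x)) (n : ℕ) (i : Fin s) :
    HasTreeSeries (elemDiff F L t₀ y₀) l h n (M.PhiBar · i) fun x => Y x i - y₀ := by
  have hO := fun i => StageEq.sub_isBigO hF.continuous hL.continuous hh hY i
  induction n generalizing i with
  | zero =>
    refine (HasTreeSeries.of_isBigO (by simpa using hO i)).congr_coeff fun τ hτ => ?_
    exact absurd hτ (by have := τ.order_pos; omega)
  | succ n ih =>
    have e1 := HasTreeSeries.sum (s := Finset.univ) fun j _ =>
      ((ih j).smul_comp_contDiff hF hh).const_smul (M.a i j)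
    have e2 := HasTreeSeries.sum (s := Finset.univ) fun j _ =>
      ((ih j).smul_taylorCoeff hh 0).const_smul (M.γ i j)
    -- Degree `q = 0` is left out because `e2` sums over all `j`, including the diagonal `j = i`.
    have e3 := HasTreeSeries.sum (s := Finset.Icc 1 n) fun q _ =>
      ((ih i).smul_taylorCoeff hh q).const_smul (M.γ i i ^ (q + 1))
    have hYb : (fun x => Y x i) =O[l] fun _ => (1 : ℝ) := by
      have : Tendsto (fun x => Y x i) l (𝓝 y₀) := by
        simpa using ((hO i).trans_tendsto hh).add_const y₀
      exact this.isBigO_one ℝ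
    have hTb : (fun x => (L (t₀ + h x * M.γ i i) - ∑ q ∈ Finset.range (n + 1),
        (h x * M.γ i i) ^ q • taylorCoeff L t₀ q) (Y x i)) =O[l] fun x => h x ^ (n + 1) := by
      refine IsBigO.trans (IsBigO.of_norm_le fun x => ContinuousLinearMap.le_opNorm _ _) ?_
      simpa using (taylor_curve_isBigO hL hh t₀ (M.γ i i) n).norm_left.mul hYb.norm_left
    have e4 : HasTreeSeries (elemDiff F L t₀ y₀) l h (n + 1) (fun _ => 0) fun x =>
        (h x * M.γ i i) • (L (t₀ + h x * M.γ i i) - ∑ q ∈ Finset.range (n + 1),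
        (h x * M.γ i i) ^ q • taylorCoeff L t₀ q) (Y x i) := by
      refine HasTreeSeries.of_isBigO ?_
      have h1 : (fun x => h x * M.γ i i) =O[l] h := by
        simpa [mul_comm] using (isBigO_refl h l).const_mul_left (M.γ i i)
      refine (h1.smul hTb).congr_right fun x => ?_
      rw [smul_eq_mul, ← pow_succ']
    refine ((((e1.add e2).add e3).add e4).congr_coeff fun τ hτ => ?_).congr_fun ?_
    · rw [M.phiBar_eq τ i hτ, add_zero]
    · filter_upwards [hY] with x hx
      simp only [add_sub_cancel]
      have hIio : ∀ u : Fin s → V, (∀ j, i ≤ j → u j = 0) →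
          ∑ j, u j = ∑ j ∈ Finset.Iio i, u j := fun u hu => by
        refine (Finset.sum_subset (Finset.subset_univ _) fun j _ hj => hu j ?_).symm
        simpa using hj
      have hIic : ∀ u : Fin s → V, (∀ j, i < j → u j = 0) →
          ∑ j, u j = ∑ j ∈ Finset.Iio i, u j + u i := fun u hu => by
        rw [← Finset.sum_subset (Finset.subset_univ (Finset.Iic i)) fun j _ hj => hu j (by
          simpa using hj), ← Finset.Iio_insert, Finset.sum_insert (by simp), add_comm]
      have t0 : taylorCoeff L t₀ 0 = L t₀ := by simp [taylorCoeff]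
      have hq : ∑ q ∈ Finset.range (n + 1), (h x * M.γ i i) ^ q • taylorCoeff L t₀ q =
          L t₀ + ∑ q ∈ Finset.Icc 1 n, (h x * M.γ i i) ^ q • taylorCoeff L t₀ q := by
        rw [Finset.range_eq_Ico, Finset.sum_eq_sum_Ico_succ_bot (by omega)]
        simp only [pow_zero, one_smul, t0]
        rfl
      rw [hIio (fun j => M.a i j • h x • F (Y x j)) (fun j hj => by simp [M.a_lower i j hj]),
        hIic (fun j => M.γ i j • h x ^ (0 + 1) • taylorCoeff L t₀ 0 (Y x j))
          (fun j hj => by simp [M.γ_lower i j hj]), hq, t0]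
      have hT : (h x * M.γ i i) • (∑ q ∈ Finset.Icc 1 n,
          (h x * M.γ i i) ^ q • taylorCoeff L t₀ q) (Y x i) = ∑ q ∈ Finset.Icc 1 n,
          M.γ i i ^ (q + 1) • h x ^ (q + 1) • taylorCoeff L t₀ q (Y x i) := by
        rw [sum_apply, Finset.smul_sum]
        refine Finset.sum_congr rfl fun q _ => ?_
        rw [smul_apply, smul_smul, smul_smul]
        congr 1
        ring
      have hA : ∑ j ∈ Finset.Iio i, M.a i j • h x • F (Y x j) =
          h x • ∑ j ∈ Finset.Iio i, M.a i j • F (Y x j) := by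
        simp only [Finset.smul_sum, smul_comm (h x)]
      have hG : ∑ j ∈ Finset.Iio i, M.γ i j • h x ^ (0 + 1) • L t₀ (Y x j) =
          h x • L t₀ (∑ j ∈ Finset.Iio i, M.γ i j • Y x j) := by
        simp only [map_sum, map_smul, Finset.smul_sum, smul_comm (h x), zero_add, pow_one]
      rw [sub_apply, add_apply, smul_sub, smul_add, hT, hA, hG]
      linear_combination (norm := module) (-1 : ℝ) • hx i

theorem StageEq.step_hasTreeSeries (hF : ContDiff ℝ ∞ F) (hL : ContDiff ℝ ∞ L)
    (hh : Tendsto h l (𝓝 0)) (hY : ∀ᶠ x in l, M.StageEq F L t₀ y₀ (h x) (Y x)) (n : ℕ) :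
    HasTreeSeries (elemDiff F L t₀ y₀) l h n (fun τ => ∑ j, M.Phi τ j) fun x =>
      h x • (∑ j, M.b j • F (Y x j)) + h x • L t₀ (∑ j, M.g j • Y x j) := by
  have hs := fun j => StageEq.hasTreeSeries hF hL hh hY n j
  have e1 := HasTreeSeries.sum (s := Finset.univ) fun j _ =>
    ((hs j).smul_comp_contDiff hF hh).const_smul (M.b j)
  have e2 := HasTreeSeries.sum (s := Finset.univ) fun j _ =>
    ((hs j).smul_taylorCoeff hh 0).const_smul (M.g j)
  refine (((e1.add e2).of_le hh n.le_succ).congr_coeff fun τ _ => ?_).congr_fun ?_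
  · simp only [phi_eq, Finset.sum_add_distrib]
  · refine Eventually.of_forall fun x => ?_
    have t0 : taylorCoeff L t₀ 0 = L t₀ := by simp [taylorCoeff]
    simp only [add_sub_cancel, t0, zero_add, pow_one, map_sum, map_smul, Finset.smul_sum]
    simp only [smul_comm (h x)]

/-- The operator `1 - h γ_ii L_i` tends to `1` and units form an open set, so each stage can be
solved from the previous ones for small `h`. -/
theorem exists_stageEq [CompleteSpace V] (F : V → V) (hL : Continuous L) (t₀ : ℝ) (y₀ : V) :
    ∀ᶠ h in 𝓝 (0 : ℝ), ∃ Y, M.StageEq F L t₀ y₀ h Y := by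
  have hu : ∀ i, ∀ᶠ h in 𝓝 (0 : ℝ),
      IsUnit (1 - (h * M.γ i i) • L (t₀ + h * M.γ i i)) := by
    intro i
    have hc : Continuous fun h : ℝ => 1 - (h * M.γ i i) • L (t₀ + h * M.γ i i) := by fun_prop
    exact hc.continuousAt.eventually_mem (Units.isOpen.mem_nhds (by simp))
  filter_upwards [eventually_all.2 hu] with h hu
  choose u hu using fun i => (hu i).exists_right_inv
  classical
  let Y : Fin s → V := WellFounded.fix (wellFounded_lt (α := Fin s)) fun i rec =>
    u i (y₀ + h • (∑ j, if hj : j < i then M.a i j • F (rec j hj) else 0) +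
      h • L t₀ (∑ j, if hj : j < i then M.γ i j • rec j hj else 0))
  have hY : ∀ i, Y i = u i (y₀ + h • (∑ j ∈ Finset.Iio i, M.a i j • F (Y j)) +
      h • L t₀ (∑ j ∈ Finset.Iio i, M.γ i j • Y j)) := by
    intro i
    have hI : Finset.Iio i = Finset.univ.filter (· < i) := by ext; simp
    rw [hI, Finset.sum_filter, Finset.sum_filter]
    simp only [Y]
    rw [WellFounded.fix_eq]
    simp only [dite_eq_ite]
  refine ⟨Y, fun i => ?_⟩
  have := congrArg (fun T : V →L[ℝ] V => T (y₀ + h • (∑ j ∈ Finset.Iio i, M.a i j • F (Y j)) +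
      h • L t₀ (∑ j ∈ Finset.Iio i, M.γ i j • Y j))) (hu i)
  simp only [mul_apply_eq_comp, ← hY, one_apply_eq_self,
    sub_apply, smul_apply] at this
  rw [← this]
  abel

end Expansion

end LIRKW2

/-! ### Expansion of the exact solution -/

namespace LWTree

open Classical in
/-- The coefficients of the exact solution: `1 / γ(τ)` on Butcher trees, `0` elsewhere. -/
noncomputable def exactCoeff (τ : LWTree) : ℝ := if τ.IsButcher then 1 / (τ.density : ℝ) else 0

theorem not_isButcher_chain (q : ℕ) (o : Option LWTree) : ¬ (chain q o).IsButcher := by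
  rcases q with _ | q <;> rcases o with _ | τ <;> simp [chain, IsButcher]

/-- The coefficient form of `y' = F(y)`: differentiating `h ^ ρ(τ)` brings down `ρ(τ)`, which
cancels the root factor of the density. -/
theorem order_mul_exactCoeff (τ : LWTree) :
    (τ.order : ℝ) * τ.exactCoeff = τ.meagreCoeff exactCoeff := by
  classical
  rcases τ.eq_meagre_or_eq_chain with ⟨m, f, rfl⟩ | ⟨q, o, rfl⟩
  · have h0 : ((meagre m f).order : ℝ) ≠ 0 := by exact_mod_cast (order_pos _).ne'
    by_cases hB : ∀ i, (f i).IsButcher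
    · simp only [exactCoeff, meagreCoeff, IsButcher, hB, if_true, implies_true, density]
      push_cast
      rw [one_div, mul_inv, mul_inv_cancel_left₀ h0]
      simp
    · have hB' := hB
      push Not at hB'
      obtain ⟨i, hi⟩ := hB'
      simp only [exactCoeff, meagreCoeff, IsButcher, hB, if_false, mul_zero]
      exact (Finset.prod_eq_zero (Finset.mem_univ i) (if_neg hi)).symm
  · simp [exactCoeff, not_isButcher_chain]

end LWTree

section Exact

variable {V : Type*} [NormedAddCommGroup V] [NormedSpace ℝ V]

theorem isBigO_pow_succ_of_deriv {r r' : ℝ → V} {T : ℝ} (hT : 0 < T) (h0 : r 0 = 0)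
    (hr : ∀ x ∈ Set.Icc 0 T, HasDerivWithinAt r (r' x) (Set.Icc 0 T) x) {k : ℕ}
    (hO : r' =O[𝓝[≥] 0] fun x => x ^ k) : r =O[𝓝[≥] 0] fun x => x ^ (k + 1) := by
  obtain ⟨C, hC0, hC⟩ := hO.exists_nonneg
  obtain ⟨ε, hε, hsub⟩ := mem_nhdsGE_iff_exists_Icc_subset.1 hC.bound
  refine IsBigO.of_bound C ?_
  filter_upwards [Icc_mem_nhdsGE hε, Icc_mem_nhdsGE hT] with x hx hxT
  have key := (convex_Icc 0 x).norm_image_sub_le_of_norm_hasDerivWithin_le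
    (f := r) (f' := r') (C := C * x ^ k) (x := 0) (y := x)
    (fun y hy => (hr y ⟨hy.1, hy.2.trans hxT.2⟩).mono (Set.Icc_subset_Icc_right hxT.2))
    (fun y hy => by
      have : ‖r' y‖ ≤ C * ‖y ^ k‖ := hsub ⟨hy.1, hy.2.trans hx.2⟩
      refine this.trans ?_
      rw [norm_pow, Real.norm_of_nonneg hy.1]
      exact mul_le_mul_of_nonneg_left (pow_le_pow_left₀ hy.1 hy.2 k) hC0)
    ⟨le_rfl, hx.1⟩ ⟨hx.1, le_rfl⟩
  rw [h0, sub_zero, sub_zero, Real.norm_of_nonneg hx.1] at key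
  rwa [norm_pow, Real.norm_of_nonneg hx.1, pow_succ, ← mul_assoc]

/-- Induction on `n`: an expansion of `φ` to order `n` expands `F(φ)` up to `O(h ^ (n + 1))`. By
`order_mul_exactCoeff` this is the derivative of the next partial sum, and the mean value inequality
gains one power of `h`. -/
theorem hasTreeSeries_exact {F : V → V} (hF : ContDiff ℝ ∞ F) (L : ℝ → V →L[ℝ] V) {t₀ tF : ℝ}
    (ht : t₀ < tF) {y₀ : V} {φ : ℝ → V} (hφ0 : φ t₀ = y₀)
    (hφ : ∀ t ∈ Set.Icc t₀ tF, HasDerivWithinAt φ (F (φ t)) (Set.Icc t₀ tF) t) (n : ℕ) :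
    HasTreeSeries (elemDiff F L t₀ y₀) (𝓝[≥] 0) id n LWTree.exactCoeff
      fun h => φ (t₀ + h) - y₀ := by
  have hT : 0 < tF - t₀ := sub_pos.2 ht
  have hψ : ∀ x ∈ Set.Icc 0 (tF - t₀), HasDerivWithinAt (fun h => φ (t₀ + h) - y₀)
      (F (φ (t₀ + x))) (Set.Icc 0 (tF - t₀)) x := by
    intro x hx
    have h1 : HasDerivWithinAt (fun h => t₀ + h) 1 (Set.Icc 0 (tF - t₀)) x :=
      (hasDerivWithinAt_id x _).const_add t₀
    have h2 := (hφ (t₀ + x) ⟨by linarith [hx.1], by linarith [hx.2]⟩).scomp x h1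
      fun y hy => ⟨by linarith [hy.1], by linarith [hy.2]⟩
    simpa using h2.sub_const y₀
  have hid : Tendsto (id : ℝ → ℝ) (𝓝[≥] 0) (𝓝 0) := tendsto_id.mono_left nhdsWithin_le_nhds
  induction n with
  | zero =>
    refine (HasTreeSeries.of_isBigO ?_).congr_coeff fun τ hτ =>
      absurd hτ (by have := τ.order_pos; omega)
    have hcont : Tendsto (fun x => F (φ (t₀ + x))) (𝓝[≥] 0) (𝓝 (F y₀)) := by
      have := (hψ 0 ⟨le_rfl, hT.le⟩).continuousWithinAt.add_const y₀
      simp only [sub_add_cancel] at this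
      have := hF.continuous.continuousAt.comp_continuousWithinAt this
      rw [← nhdsWithin_Icc_eq_nhdsGE hT]
      simpa [ContinuousWithinAt, hφ0, Function.comp_def] using this
    exact isBigO_pow_succ_of_deriv hT (by simp [hφ0]) hψ (by simpa using hcont.isBigO_one ℝ)
  | succ n ih =>
    have hc := HasTreeSeries.comp_contDiff hF hid ih
    refine isBigO_pow_succ_of_deriv hT ?_ (fun x hx => ?_) hc
    · rw [Finset.sum_eq_zero fun τ _ => by simp [τ.order_pos.ne']]
      simp [hφ0]
    · have hd : HasDerivWithinAt (fun x : ℝ => ∑ τ ∈ LWTree.treesLE (n + 1),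
          (id x ^ τ.order * τ.exactCoeff) • elemDiff F L t₀ y₀ τ)
          (∑ τ ∈ LWTree.treesLE (n + 1), (id x ^ (τ.order - 1) *
            τ.meagreCoeff LWTree.exactCoeff) • elemDiff F L t₀ y₀ τ) (Set.Icc 0 (tF - t₀)) x := by
        refine HasDerivWithinAt.fun_sum fun τ _ => ?_
        have := (((hasDerivWithinAt_id x (Set.Icc 0 (tF - t₀))).fun_pow τ.order).mul_const
          τ.exactCoeff).smul_const (elemDiff F L t₀ y₀ τ)
        convert this using 2
        rw [← LWTree.order_mul_exactCoeff]
        simp only [id]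
        ring
      simpa using (hψ x hx).fun_sub hd

end Exact

/-! ### Sufficiency of the order conditions -/

namespace LIRKW2

variable {s : ℕ} {M : LIRKW2 s}

/-- A curve of matrices as a curve of continuous linear maps. -/
noncomputable def matrixCurve {N : ℕ} (L : ℝ → Matrix (Fin N) (Fin N) ℝ) (t : ℝ) :
    (Fin N → ℝ) →L[ℝ] (Fin N → ℝ) :=
  (L t).mulVecLin.toContinuousLinearMap

theorem contDiff_matrixCurve {N : ℕ} {L : ℝ → Matrix (Fin N) (Fin N) ℝ}
    (hL : ∀ k l, ContDiff ℝ ∞ fun t => L t k l) : ContDiff ℝ ∞ (matrixCurve L) := by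
  refine contDiff_clm_apply_iff.2 fun v => contDiff_pi.2 fun k => ?_
  simp only [matrixCurve, LinearMap.coe_toContinuousLinearMap', Matrix.mulVecLin_apply,
    Matrix.mulVec, dotProduct]
  exact ContDiff.sum fun l _ => (hL k l).mul contDiff_const

theorem hasOrder_of_sum_phi {p : ℕ}
    (H : ∀ τ : LWTree, τ.order ≤ p → ∑ j, M.Phi τ j = τ.exactCoeff) : M.HasOrder p := by
  intro N F L t₀ tF y₀ φ hF hL ht hφ
  have hLc := contDiff_matrixCurve hL
  -- A filter on pairs `(h, Y)` with `h → 0+` and `Y` any solution of the stage equations, so that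
  -- the resulting constant is uniform in `Y`.
  set l : Filter (ℝ × (Fin s → Fin N → ℝ)) := comap Prod.fst (𝓝[>] 0) ⊓
    𝓟 {x | M.IsStages F L t₀ y₀ x.1 x.2} with hl
  have hfst : Tendsto Prod.fst l (𝓝[>] (0 : ℝ)) := tendsto_comap.mono_left inf_le_left
  have hY : ∀ᶠ x in l, M.StageEq F (matrixCurve L) t₀ y₀ x.1 x.2 := by
    have : ∀ᶠ x in l, M.IsStages F L t₀ y₀ x.1 x.2 := mem_inf_of_right (mem_principal_self _)
    exact this
  have h0 : Tendsto Prod.fst l (𝓝 (0 : ℝ)) := hfst.mono_right nhdsWithin_le_nhds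
  have e1 := StageEq.step_hasTreeSeries hF hLc h0 hY p
  have e2 := (hasTreeSeries_exact hF (matrixCurve L) ht hφ.1 hφ.2 p).comp_tendsto
    (hfst.mono_right (nhdsWithin_mono _ Set.Ioi_subset_Ici_self))
  have e3 : (fun x => M.step F L t₀ y₀ x.1 x.2 - φ (t₀ + x.1)) =O[l] fun x => x.1 ^ (p + 1) := by
    refine (IsBigO.sub (e1.congr_coeff fun τ hτ => H τ hτ) e2).congr_left fun x => ?_
    simp only [Function.comp_apply, id, step]
    rw [show ∀ v, (matrixCurve L t₀) v = (L t₀).mulVec v from fun v => rfl]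
    abel
  obtain ⟨C, hC⟩ := e3.bound
  refine ⟨C, ?_⟩
  rw [hl, eventually_inf_principal, eventually_comap] at hC
  filter_upwards [hC, self_mem_nhdsWithin,
    (exists_stageEq (M := M) F hLc.continuous t₀ y₀).filter_mono nhdsWithin_le_nhds]
    with h hC hpos hex
  refine ⟨hex, fun Y hYs => ?_⟩
  have := hC (h, Y) rfl hYs
  rwa [norm_pow, Real.norm_of_nonneg (le_of_lt hpos)] at this

end LIRKW2

/-! ### Necessity of the order conditions

The test problem has one coordinate for each tree with at most `p` vertices, whose exact and
numerical values are the weights of that tree, and one constant coordinate. -/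

namespace LWTree

/-- The coordinates of the test problem. -/
abbrev Coord (p : ℕ) := Option (treesLE p)

/-- The dimension of the test problem. -/
noncomputable abbrev testDim (p : ℕ) : ℕ := Fintype.card (Coord p)

/-- The numbering of the coordinates of the test problem. -/
noncomputable def coordEquiv (p : ℕ) : Coord p ≃ Fin (testDim p) := Fintype.equivFin _

/-- The constant coordinate. -/
noncomputable def unitIdx (p : ℕ) : Fin (testDim p) := coordEquiv p none

open Classical in
/-- The coordinate of a tree. -/
noncomputable def idx (p : ℕ) (τ : LWTree) : Fin (testDim p) :=
  if h : τ ∈ treesLE p then coordEquiv p (some ⟨τ, h⟩) else unitIdx p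

/-- The row of the vector field that belongs to a tree. -/
noncomputable def fieldRow (p : ℕ) (y : Fin (testDim p) → ℝ) : LWTree → ℝ
  | meagre _ f => ∏ i, y (idx p (f i))
  | _ => 0

/-- The row of the matrix that belongs to a tree. -/
noncomputable def matrixRow (p : ℕ) (t : ℝ) : LWTree → Fin (testDim p) → ℝ
  | meagre _ _ => 0
  | fatLeaf => Pi.single (unitIdx p) 1
  | fat τ => Pi.single (idx p τ) 1
  | thetaLeaf q => Pi.single (unitIdx p) (t ^ (q : ℕ))
  | theta q τ => Pi.single (idx p τ) (t ^ (q : ℕ))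

/-- The vector field of the test problem. -/
noncomputable def testField (p : ℕ) (y : Fin (testDim p) → ℝ) (k : Fin (testDim p)) : ℝ :=
  ((coordEquiv p).symm k).elim 0 fun τ => fieldRow p y τ

/-- The matrix of the test problem. -/
noncomputable def testMatrix (p : ℕ) (t : ℝ) : Matrix (Fin (testDim p)) (Fin (testDim p)) ℝ :=
  fun k => ((coordEquiv p).symm k).elim 0 fun τ => matrixRow p t τ

/-- The exact solution of the test problem. -/
noncomputable def testSol (p : ℕ) (t : ℝ) (k : Fin (testDim p)) : ℝ :=
  ((coordEquiv p).symm k).elim 1 fun τ => t ^ τ.1.order * τ.1.exactCoeff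

variable {p : ℕ} {τ : LWTree}

/-- The other branch of `idx` is never relevant: the row of a tree with at most `p` vertices refers
only to its subtrees, which are smaller. -/
theorem idx_eq (hτ : τ.order ≤ p) : idx p τ = coordEquiv p (some ⟨τ, mem_treesLE.2 hτ⟩) :=
  dif_pos (mem_treesLE.2 hτ)

theorem eq_unitIdx_or_eq_idx (k : Fin (testDim p)) :
    k = unitIdx p ∨ ∃ τ : LWTree, τ.order ≤ p ∧ k = idx p τ := by
  obtain ⟨o, rfl⟩ := (coordEquiv p).surjective k
  rcases o with _ | ⟨τ, hτ⟩
  · exact .inl rfl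
  · exact .inr ⟨τ, mem_treesLE.1 hτ, (idx_eq (mem_treesLE.1 hτ)).symm⟩

@[simp] theorem testField_unitIdx (y : Fin (testDim p) → ℝ) : testField p y (unitIdx p) = 0 := by
  simp [testField, unitIdx]

theorem testField_idx (hτ : τ.order ≤ p) (y : Fin (testDim p) → ℝ) :
    testField p y (idx p τ) = fieldRow p y τ := by
  simp [testField, idx_eq hτ]

@[simp] theorem testMatrix_unitIdx (t : ℝ) : testMatrix p t (unitIdx p) = 0 := by
  simp [testMatrix, unitIdx]

theorem testMatrix_idx (hτ : τ.order ≤ p) (t : ℝ) :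
    testMatrix p t (idx p τ) = matrixRow p t τ := by
  simp [testMatrix, idx_eq hτ]

@[simp] theorem testSol_unitIdx (t : ℝ) : testSol p t (unitIdx p) = 1 := by
  simp [testSol, unitIdx]

theorem testSol_idx (hτ : τ.order ≤ p) (t : ℝ) :
    testSol p t (idx p τ) = t ^ τ.order * τ.exactCoeff := by
  simp [testSol, idx_eq hτ]

theorem contDiff_testField : ContDiff ℝ ∞ (testField p) := by
  refine contDiff_pi.2 fun k => ?_
  rcases eq_unitIdx_or_eq_idx k with rfl | ⟨τ, hτ, rfl⟩
  · simpa using contDiff_const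
  · simp only [testField_idx hτ]
    cases τ with
    | meagre m f => exact contDiff_prod fun i _ => contDiff_apply ℝ ℝ _
    | _ => exact contDiff_const

theorem contDiff_testMatrix (k l : Fin (testDim p)) :
    ContDiff ℝ ∞ fun t => testMatrix p t k l := by
  classical
  rcases eq_unitIdx_or_eq_idx k with rfl | ⟨τ, hτ, rfl⟩
  · simpa using contDiff_const
  · simp only [testMatrix_idx hτ]
    cases τ <;> simp only [matrixRow, Pi.single_apply, Pi.zero_apply]
    any_goals exact contDiff_const
    all_goals
      split_ifs
      · exact contDiff_id.pow _
      · exact contDiff_const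

/-- Each row is the recursion `order_mul_exactCoeff` times a power of `t`. -/
theorem isSolutionOn_testSol :
    IsSolutionOn (testField p) 0 1 (testSol p 0) (testSol p) := by
  refine ⟨rfl, fun t _ => hasDerivWithinAt_pi.2 fun k => ?_⟩
  rcases eq_unitIdx_or_eq_idx k with rfl | ⟨τ, hτ, rfl⟩
  · simpa using hasDerivWithinAt_const _ _ _
  · simp only [testSol_idx hτ, testField_idx hτ]
    have h1 := ((hasDerivWithinAt_id t (Set.Icc (0 : ℝ) 1)).fun_pow τ.order).mul_const τ.exactCoeff
    suffices e : fieldRow p (testSol p t) τ =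
        τ.order * id t ^ (τ.order - 1) * 1 * τ.exactCoeff by
      rw [e]
      exact h1
    have h2 := order_mul_exactCoeff τ
    simp only [id, mul_one]
    rw [mul_right_comm, h2]
    cases τ with
    | meagre m f =>
      simp only [fieldRow, meagreCoeff, order, add_tsub_cancel_left]
      rw [← Finset.prod_pow_eq_pow_sum, mul_comm, ← Finset.prod_mul_distrib]
      refine Finset.prod_congr rfl fun i _ => testSol_idx ?_ t
      have := order_le_of_meagre f i
      omega
    | _ => simp [fieldRow, meagreCoeff]

end LWTree

namespace LIRKW2

open LWTree

variable {s : ℕ} {M : LIRKW2 s} {p : ℕ} {h : ℝ} {Y : Fin s → Fin (testDim p) → ℝ}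

theorem sum_a_eq (i : Fin s) (u : Fin s → ℝ) :
    ∑ j ∈ Finset.Iio i, M.a i j * u j = ∑ j, M.a i j * u j := by
  refine Finset.sum_subset (Finset.subset_univ _) fun j _ hj => ?_
  rw [M.a_lower i j (by simpa using hj), zero_mul]

theorem sum_gamma_eq (i : Fin s) (u : Fin s → ℝ) :
    ∑ j ∈ Finset.Iio i, M.γ i j * u j + M.γ i i * u i = ∑ j, M.γ i j * u j := by
  rw [← Finset.sum_subset (Finset.subset_univ (Finset.Iic i)) fun j _ hj => by
    rw [M.γ_lower i j (by simpa using hj), zero_mul], ← Finset.Iio_insert,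
    Finset.sum_insert (by simp), add_comm]

/-- The constant coordinate lets the linear term `L y` produce the inhomogeneities needed for
childless fat vertices. -/
theorem IsStages.apply_unitIdx
    (hY : M.IsStages (testField p) (testMatrix p) 0 (testSol p 0) h Y) (i : Fin s) :
    Y i (unitIdx p) = 1 := by
  rw [hY i]
  simp [Matrix.mulVec]

theorem testSol_zero_idx {τ : LWTree} (hτ : τ.order ≤ p) : testSol p 0 (idx p τ) = 0 := by
  rw [testSol_idx hτ, zero_pow τ.order_pos.ne', zero_mul]

/-- An exact identity, by induction on the tree. In a row with `q ≥ 1` squares the entry `t ^ q`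
vanishes at `t₀ = 0`, so only the implicit term survives and gives `(h γ_ii) ^ (q + 1)`. -/
theorem IsStages.apply_idx
    (hY : M.IsStages (testField p) (testMatrix p) 0 (testSol p 0) h Y) {τ : LWTree}
    (hτ : τ.order ≤ p) (i : Fin s) : Y i (idx p τ) = h ^ τ.order * M.PhiBar τ i := by
  have e : ∀ {τ : LWTree}, τ.order ≤ p → ∀ i, Y i (idx p τ) =
      h * ∑ j, M.a i j * fieldRow p (Y j) τ +
      h * matrixRow p 0 τ ⬝ᵥ (∑ j ∈ Finset.Iio i, M.γ i j • Y j) +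
      h * M.γ i i * matrixRow p (h * M.γ i i) τ ⬝ᵥ Y i := by
    intro τ hτ i
    rw [← sum_a_eq]
    nth_rewrite 1 [hY i]
    simp [Matrix.mulVec, testSol_zero_idx hτ, testField_idx hτ, testMatrix_idx hτ]
  induction τ generalizing i with
  | meagre m f ih =>
    have ih' : ∀ k j, Y j (idx p (f k)) = h ^ (f k).order * M.PhiBar (f k) j := fun k =>
      ih k ((order_le_of_meagre f k).le.trans hτ)
    rw [e hτ]
    simp only [fieldRow, matrixRow, ih', zero_dotProduct, mul_zero, add_zero,
      Finset.prod_mul_distrib, Finset.prod_pow_eq_pow_sum, PhiBar, order, pow_add, pow_one]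
    simp only [Finset.mul_sum]
    exact Finset.sum_congr rfl fun j _ => by ring
  | fatLeaf =>
    rw [e hτ]
    simp only [fieldRow, matrixRow, single_dotProduct, Finset.sum_apply, Pi.smul_apply,
      smul_eq_mul, mul_zero, Finset.sum_const_zero, zero_add, one_mul, hY.apply_unitIdx, PhiBar, order,
      pow_one]
    have := sum_gamma_eq (M := M) i fun _ => 1
    simp only [mul_one] at this ⊢
    rw [← this]
    ring
  | fat τ ih =>
    have ih' := ih ((Nat.le_add_left _ _).trans hτ)
    rw [e hτ]
    simp only [fieldRow, matrixRow, single_dotProduct, Finset.sum_apply, Pi.smul_apply,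
      smul_eq_mul, mul_zero, Finset.sum_const_zero, zero_add, one_mul, PhiBar, order, ih']
    have := sum_gamma_eq (M := M) i fun j => h ^ τ.order * M.PhiBar τ j
    rw [mul_assoc, ← mul_add, this, pow_add, pow_one, mul_assoc, Finset.mul_sum (a := h ^ τ.order)]
    congr 1
    exact Finset.sum_congr rfl fun j _ => by ring
  | thetaLeaf q =>
    rw [e hτ]
    simp only [fieldRow, matrixRow, single_dotProduct, mul_zero, Finset.sum_const_zero, zero_add,
      zero_pow q.ne_zero, zero_mul, hY.apply_unitIdx, PhiBar, order]
    ring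
  | theta q τ ih =>
    have ih' := ih ((Nat.le_add_left _ _).trans hτ)
    rw [e hτ]
    simp only [fieldRow, matrixRow, single_dotProduct, mul_zero, Finset.sum_const_zero, zero_add,
      zero_pow q.ne_zero, zero_mul, ih', PhiBar, order]
    ring

theorem IsStages.step_idx
    (hY : M.IsStages (testField p) (testMatrix p) 0 (testSol p 0) h Y) {τ : LWTree}
    (hτ : τ.order ≤ p) : M.step (testField p) (testMatrix p) 0 (testSol p 0) h Y (idx p τ) =
      h ^ τ.order * ∑ j, M.Phi τ j := by
  have e : M.step (testField p) (testMatrix p) 0 (testSol p 0) h Y (idx p τ) =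
      h * ∑ j, M.b j * fieldRow p (Y j) τ + h * matrixRow p 0 τ ⬝ᵥ (∑ j, M.g j • Y j) := by
    simp [step, Matrix.mulVec, testSol_zero_idx hτ, testField_idx hτ, testMatrix_idx hτ]
  rw [e]
  cases τ with
  | meagre m f =>
    have ih : ∀ k j, Y j (idx p (f k)) = h ^ (f k).order * M.PhiBar (f k) j := fun k =>
      hY.apply_idx ((order_le_of_meagre f k).le.trans hτ)
    simp only [fieldRow, matrixRow, ih, zero_dotProduct, mul_zero, add_zero,
      Finset.prod_mul_distrib, Finset.prod_pow_eq_pow_sum, Phi, order, pow_add, pow_one]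
    simp only [Finset.mul_sum]
    exact Finset.sum_congr rfl fun j _ => by ring
  | fatLeaf =>
    simp [fieldRow, matrixRow, hY.apply_unitIdx, Phi, order]
  | fat τ =>
    simp only [fieldRow, matrixRow, single_dotProduct, Finset.sum_apply, Pi.smul_apply,
      smul_eq_mul, mul_zero, Finset.sum_const_zero, zero_add, one_mul, Phi, order,
      hY.apply_idx ((Nat.le_add_left _ _).trans hτ)]
    simp only [Finset.mul_sum, pow_add, pow_one]
    exact Finset.sum_congr rfl fun j _ => by ring
  | thetaLeaf q => simp [fieldRow, matrixRow, Phi]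
  | theta q τ => simp [fieldRow, matrixRow, Phi]

/-- Dividing the error in coordinate `τ` by `h ^ ρ(τ)` leaves a constant bounded by `C h ^ (p + 1 -
ρ(τ))`, which tends to zero. -/
theorem HasOrder.sum_phi (H : M.HasOrder p) {τ : LWTree} (hτ : τ.order ≤ p) :
    ∑ j, M.Phi τ j = τ.exactCoeff := by
  obtain ⟨C, hC⟩ := H (testDim p) (testField p) (testMatrix p) 0 1 (testSol p 0) (testSol p)
    contDiff_testField contDiff_testMatrix zero_lt_one isSolutionOn_testSol
  have hbound : ∀ᶠ h in 𝓝[>] (0 : ℝ),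
      |∑ j, M.Phi τ j - τ.exactCoeff| ≤ C * h ^ (p + 1 - τ.order) := by
    filter_upwards [hC, self_mem_nhdsWithin] with h hh hpos
    obtain ⟨⟨Y, hY⟩, hle⟩ := hh
    have hpos' : 0 < h ^ τ.order := pow_pos hpos _
    have h1 := (norm_le_pi_norm _ (idx p τ)).trans (hle Y hY)
    rw [Pi.sub_apply, hY.step_idx hτ, zero_add, testSol_idx hτ, ← mul_sub, norm_mul,
      Real.norm_of_nonneg hpos'.le, Real.norm_eq_abs,
      ← Nat.sub_add_cancel (hτ.trans p.le_succ : τ.order ≤ p + 1), pow_add, ← mul_assoc,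
      mul_comm] at h1
    exact le_of_mul_le_mul_right h1 hpos'
  have hlim : Tendsto (fun h : ℝ => C * h ^ (p + 1 - τ.order)) (𝓝[>] 0) (𝓝 0) := by
    have hc : Continuous fun h : ℝ => C * h ^ (p + 1 - τ.order) := by fun_prop
    have := (hc.tendsto 0).mono_left (nhdsWithin_le_nhds (s := Set.Ioi 0))
    simpa [zero_pow (show p + 1 - τ.order ≠ 0 by omega)] using this
  exact sub_eq_zero.1 (abs_nonpos_iff.1 (ge_of_tendsto hlim hbound))

theorem hasOrder_iff : M.HasOrder p ↔
    ∀ τ : LWTree, τ.order ≤ p → ∑ j, M.Phi τ j = τ.exactCoeff :=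
  ⟨fun H _ hτ => H.sum_phi hτ, hasOrder_of_sum_phi⟩

end LIRKW2

theorem theorem2 {s : ℕ} (M : LIRKW2 s) (p : ℕ) :
    M.HasOrder p ↔
      (∀ τ : LWTree, τ.IsButcher → τ.order ≤ p →
        ∑ j, M.Phi τ j = 1 / (τ.density : ℝ)) ∧
      (∀ τ : LWTree, τ.IsLW2 → ¬ τ.IsButcher → τ.order ≤ p →
        ∑ j, M.Phi τ j = 0) := by
  rw [LIRKW2.hasOrder_iff]
  constructor
  · intro H
    exact ⟨fun τ hB hτ => (H τ hτ).trans (if_pos hB), fun τ _ hB hτ => (H τ hτ).trans (if_neg hB)⟩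
  · rintro ⟨H1, H2⟩ τ hτ
    by_cases hB : τ.IsButcher
    · exact (H1 τ hB hτ).trans (if_pos hB).symm
    · refine Eq.trans ?_ (if_neg hB).symm
      by_cases hL : τ.IsLW2
      · exact H2 τ hL hB hτ
      -- Only square roots remain, where `Phi` is zero by convention.
      · cases τ <;> simp_all [LWTree.IsLW2, LIRKW2.Phi]
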